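/- Throughout, algebras are finite-dimensional over an arbitrary field $F$. A Poisson algebra is a vector space $P$ with two bilinear multiplications $\cdot$ and $[\,,\,]$ such that $(P,\cdot)$ is a commutative associative algebra (not necessarily unital), $(P,[\,,\,])$ is a Lie algebra, and $[x\cdot y,z]=[x,z]\cdot y+x\cdot[y,z]$ for all $x,y,z\in P$. A subalgebra is a linear subspace closed under both multiplications; an ideal of $P$ is a linear subspace $I$ with $I\cdot P+[I,P]\subseteq I$. A subalgebra $B$ is a subideal of $P$ if there is a chain of subalgebras $B=B_0\subseteq B_1\subseteq\dots\subseteq B_r=P$ with $B_i$ an ideal of $B_{i+1}$ for $0\le i\le r-1$. The Frattini ideal $\phi(P)$ is the largest ideal of $P$ contained in the intersection of all maximal subalgebras of $P$. A Poisson algebra $A$ is nilpotent if $A^m=0$ for some $m\ge1$, where $A^1=A$ and $A^{n+1}=\sum_{i=1}^{n}\left(A^i\cdot A^{n+1-i}+[A^i,A^{n+1-i}]\right)$; it is supersolvable if there is a flag $0=A_0\subset A_1\subset\dots\subset A_n=A$ of ideals of $A$ with $\dim A_i=i$ for every $i$. Theorem. Let $B$ be a subideal of a finite-dimensional Poisson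 algebra $P$ over a field $F$, and let $C$ be an ideal of $B$ with $C\subseteq\phi(P)$. If $B/C$ is nilpotent, then $B$ is nilpotent; if $B/C$ is supersolvable, then $B$ is supersolvable. -/

import Mathlib

/-- A (not necessarily unital) commutative associative ring which is also a Lie ring on the same
additive group, subject to the Leibniz rule. -/
class PoissonRing (P : Type*) extends NonUnitalCommRing P, LieRing P where
  leibniz (x y z : P) : ⁅x * y, z⁆ = ⁅x, z⁆ * y + x * ⁅y, z⁆

/-- A Poisson algebra over `F`: both multiplications of the Poisson ring are `F`-bilinear. -/
class PoissonAlgebra (F P : Type*) [Field F] [PoissonRing P] extends LieAlgebra F P where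
  smul_mul (c : F) (x y : P) : (c • x) * y = c • (x * y)

section Sub

variable (F P : Type*) [Field F] [PoissonRing P] [PoissonAlgebra F P]

/-- A subalgebra: a linear subspace closed under both multiplications. -/
structure PoissonSubalgebra extends Submodule F P where
  mul_mem {x y : P} : x ∈ carrier → y ∈ carrier → x * y ∈ carrier
  lie_mem {x y : P} : x ∈ carrier → y ∈ carrier → ⁅x, y⁆ ∈ carrier

/-- A (Poisson) ideal: a linear subspace absorbing both multiplications. One side suffices, since
the product is commutative and the bracket is anticommutative. -/
structure PoissonIdeal extends Submodule F P where
  mul_mem {x y : P} : x ∈ carrier → x * y ∈ carrier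
  lie_mem {x y : P} : x ∈ carrier → ⁅x, y⁆ ∈ carrier

end Sub

section Basic

variable {F P : Type*} [Field F] [PoissonRing P] [PoissonAlgebra F P]

namespace PoissonSubalgebra

instance : SetLike (PoissonSubalgebra F P) P where
  coe S := S.carrier
  coe_injective S T h := by
    rcases S with ⟨⟨⟩⟩
    rcases T with ⟨⟨⟩⟩
    congr
    exact SetLike.coe_injective h

instance : PartialOrder (PoissonSubalgebra F P) := .ofSetLike (PoissonSubalgebra F P) P

instance : OrderTop (PoissonSubalgebra F P) where
  top := { (⊤ : Submodule F P) with mul_mem := fun _ _ => trivial, lie_mem := fun _ _ => trivial }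
  le_top _ _ _ := trivial

/-- A subalgebra is itself a Poisson ring, with the restricted operations. -/
instance (S : PoissonSubalgebra F P) : PoissonRing S :=
  { (inferInstance : AddCommGroup S.toSubmodule) with
    mul := fun x y => ⟨x.1 * y.1, S.mul_mem x.2 y.2⟩
    bracket := fun x y => ⟨⁅x.1, y.1⁆, S.lie_mem x.2 y.2⟩
    left_distrib := fun x y z => Subtype.ext (mul_add x.1 y.1 z.1)
    right_distrib := fun x y z => Subtype.ext (add_mul x.1 y.1 z.1)
    zero_mul := fun x => Subtype.ext (zero_mul x.1)
    mul_zero := fun x => Subtype.ext (mul_zero x.1)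
    mul_assoc := fun x y z => Subtype.ext (mul_assoc x.1 y.1 z.1)
    mul_comm := fun x y => Subtype.ext (mul_comm x.1 y.1)
    add_lie := fun x y z => Subtype.ext (add_lie x.1 y.1 z.1)
    lie_add := fun x y z => Subtype.ext (lie_add x.1 y.1 z.1)
    lie_self := fun x => Subtype.ext (lie_self x.1)
    leibniz_lie := fun x y z => Subtype.ext (leibniz_lie x.1 y.1 z.1)
    leibniz := fun x y z => Subtype.ext (PoissonRing.leibniz x.1 y.1 z.1) }

/-- A subalgebra is itself a Poisson algebra. -/
instance (S : PoissonSubalgebra F P) : PoissonAlgebra F S :=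
  { (inferInstance : Module F S.toSubmodule) with
    lie_smul := fun c x y => Subtype.ext (lie_smul c x.1 y.1)
    smul_mul := fun c x y => Subtype.ext (PoissonAlgebra.smul_mul c x.1 y.1) }

@[simp] theorem coe_mul (S : PoissonSubalgebra F P) (x y : S) : ((x * y : S) : P) = x * y := rfl

@[simp] theorem coe_lie (S : PoissonSubalgebra F P) (x y : S) :
    ((⁅x, y⁆ : S) : P) = ⁅(x : P), (y : P)⁆ :=
  rfl

/-- `S` is contained in the subalgebra `T` and is an ideal of `T`. -/
def IsIdealOf (S T : PoissonSubalgebra F P) : Prop :=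
  S ≤ T ∧ ∀ x ∈ S, ∀ y ∈ T, x * y ∈ S ∧ ⁅x, y⁆ ∈ S

/-- `B` is a subideal of `P`: there is a chain of subalgebras `B = B₀ ⊆ B₁ ⊆ ⋯ ⊆ Bᵣ = P` in which
each term is an ideal of the next. -/
def IsSubideal (B : PoissonSubalgebra F P) : Prop :=
  ∃ (r : ℕ) (c : ℕ → PoissonSubalgebra F P),
    c 0 = B ∧ c r = ⊤ ∧ ∀ i < r, (c i).IsIdealOf (c (i + 1))

end PoissonSubalgebra

namespace PoissonIdeal

instance : SetLike (PoissonIdeal F P) P where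
  coe S := S.carrier
  coe_injective S T h := by
    rcases S with ⟨⟨⟩⟩
    rcases T with ⟨⟨⟩⟩
    congr
    exact SetLike.coe_injective h

instance : PartialOrder (PoissonIdeal F P) := .ofSetLike (PoissonIdeal F P) P

theorem mul_sub_mul_mem (I : PoissonIdeal F P) {x x' y y' : P} (hx : x - x' ∈ I.toSubmodule)
    (hy : y - y' ∈ I.toSubmodule) : x * y - x' * y' ∈ I.toSubmodule := by
  have h : x * y - x' * y' = (x - x') * y + (y - y') * x' := by
    rw [sub_mul, sub_mul, mul_comm y x', mul_comm y' x']; abel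
  rw [h]
  exact I.toSubmodule.add_mem (I.mul_mem hx) (I.mul_mem hy)

theorem lie_sub_lie_mem (I : PoissonIdeal F P) {x x' y y' : P} (hx : x - x' ∈ I.toSubmodule)
    (hy : y - y' ∈ I.toSubmodule) : ⁅x, y⁆ - ⁅x', y'⁆ ∈ I.toSubmodule := by
  have h : ⁅x, y⁆ - ⁅x', y'⁆ = ⁅x - x', y⁆ - ⁅y - y', x'⁆ := by
    rw [sub_lie, sub_lie, ← lie_skew x' y, ← lie_skew x' y']; abel
  rw [h]
  exact I.toSubmodule.sub_mem (I.lie_mem hx) (I.lie_mem hy)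

/-- The quotient of a Poisson algebra by an ideal, as a vector space. -/
instance : HasQuotient P (PoissonIdeal F P) := ⟨fun I => P ⧸ I.toSubmodule⟩

/-- The class `x + I`. -/
def toQuotient (I : PoissonIdeal F P) (x : P) : P ⧸ I := Submodule.Quotient.mk (p := I.toSubmodule) x

/-- The quotient of a Poisson algebra by an ideal is a Poisson ring, with
`(x + I) * (y + I) = x * y + I` and `⁅x + I, y + I⁆ = ⁅x, y⁆ + I`. -/
instance (I : PoissonIdeal F P) : PoissonRing (P ⧸ I) :=
  { (inferInstance : AddCommGroup (P ⧸ I.toSubmodule)) with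
    mul := Quotient.map₂ (· * ·) fun _ _ hx _ _ hy =>
      (Submodule.quotientRel_def _).2 (I.mul_sub_mul_mem ((Submodule.quotientRel_def _).1 hx)
        ((Submodule.quotientRel_def _).1 hy))
    bracket := Quotient.map₂ (fun x y => ⁅x, y⁆) fun _ _ hx _ _ hy =>
      (Submodule.quotientRel_def _).2 (I.lie_sub_lie_mem ((Submodule.quotientRel_def _).1 hx)
        ((Submodule.quotientRel_def _).1 hy))
    left_distrib := by rintro ⟨x⟩ ⟨y⟩ ⟨z⟩; exact congrArg I.toQuotient (mul_add x y z)
    right_distrib := by rintro ⟨x⟩ ⟨y⟩ ⟨z⟩; exact congrArg I.toQuotient (add_mul x y z)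
    zero_mul := by rintro ⟨x⟩; exact congrArg I.toQuotient (zero_mul x)
    mul_zero := by rintro ⟨x⟩; exact congrArg I.toQuotient (mul_zero x)
    mul_assoc := by rintro ⟨x⟩ ⟨y⟩ ⟨z⟩; exact congrArg I.toQuotient (mul_assoc x y z)
    mul_comm := by rintro ⟨x⟩ ⟨y⟩; exact congrArg I.toQuotient (mul_comm x y)
    add_lie := by rintro ⟨x⟩ ⟨y⟩ ⟨z⟩; exact congrArg I.toQuotient (add_lie x y z)
    lie_add := by rintro ⟨x⟩ ⟨y⟩ ⟨z⟩; exact congrArg I.toQuotient (lie_add x y z)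
    lie_self := by rintro ⟨x⟩; exact congrArg I.toQuotient (lie_self x)
    leibniz_lie := by rintro ⟨x⟩ ⟨y⟩ ⟨z⟩; exact congrArg I.toQuotient (leibniz_lie x y z)
    leibniz := by rintro ⟨x⟩ ⟨y⟩ ⟨z⟩; exact congrArg I.toQuotient (PoissonRing.leibniz x y z) }

/-- The quotient Poisson algebra. -/
instance (I : PoissonIdeal F P) : PoissonAlgebra F (P ⧸ I) :=
  { (inferInstance : Module F (P ⧸ I.toSubmodule)) with
    lie_smul := by rintro c ⟨x⟩ ⟨y⟩; exact congrArg I.toQuotient (lie_smul c x y)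
    smul_mul := by rintro c ⟨x⟩ ⟨y⟩; exact congrArg I.toQuotient (PoissonAlgebra.smul_mul c x y) }

theorem toQuotient_mul (I : PoissonIdeal F P) (x y : P) : I.toQuotient (x * y) = I.toQuotient x * I.toQuotient y := rfl

theorem toQuotient_lie (I : PoissonIdeal F P) (x y : P) : I.toQuotient ⁅x, y⁆ = ⁅I.toQuotient x, I.toQuotient y⁆ := rfl

end PoissonIdeal

end Basic

namespace PoissonAlgebra

variable (F P : Type*) [Field F] [PoissonRing P] [PoissonAlgebra F P]

/-- The Frattini subalgebra `F(P)`: the intersection of the maximal (proper) subalgebras. -/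
def frattini : PoissonSubalgebra F P where
  carrier := {x | ∀ M : PoissonSubalgebra F P, IsCoatom M → x ∈ M}
  add_mem' hx hy M hM := M.toSubmodule.add_mem (hx M hM) (hy M hM)
  zero_mem' M _ := M.toSubmodule.zero_mem
  smul_mem' c _ hx M hM := M.toSubmodule.smul_mem c (hx M hM)
  mul_mem hx hy M hM := M.mul_mem (hx M hM) (hy M hM)
  lie_mem hx hy M hM := M.lie_mem (hx M hM) (hy M hM)

/-- The Frattini ideal `φ(P)`: the sum of all ideals contained in the Frattini subalgebra, i.e. the
largest such ideal (see `frattiniIdeal_isGreatest`). -/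
def frattiniIdeal : PoissonIdeal F P where
  toSubmodule := ⨆ I : {I : PoissonIdeal F P // (I : Set P) ⊆ frattini F P}, I.1.toSubmodule
  mul_mem {x y} hx := by
    refine Submodule.iSup_induction (fun I : {I : PoissonIdeal F P // (I : Set P) ⊆ frattini F P} =>
      I.1.toSubmodule) (motive := fun x => x * y ∈ _) hx
      (fun I x hx => Submodule.mem_iSup_of_mem I (I.1.mul_mem hx)) ?_ (fun a b ha hb => ?_)
    · rw [zero_mul]; exact Submodule.zero_mem _
    · rw [add_mul]; exact Submodule.add_mem _ ha hb
  lie_mem {x y} hx := by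
    refine Submodule.iSup_induction (fun I : {I : PoissonIdeal F P // (I : Set P) ⊆ frattini F P} =>
      I.1.toSubmodule) (motive := fun x => ⁅x, y⁆ ∈ _) hx
      (fun I x hx => Submodule.mem_iSup_of_mem I (I.1.lie_mem hx)) ?_ (fun a b ha hb => ?_)
    · rw [zero_lie]; exact Submodule.zero_mem _
    · rw [add_lie]; exact Submodule.add_mem _ ha hb

theorem frattiniIdeal_isGreatest :
    IsGreatest {I : PoissonIdeal F P | (I : Set P) ⊆ frattini F P} (frattiniIdeal F P) := by
  constructor
  · have h : (frattiniIdeal F P).toSubmodule ≤ (frattini F P).toSubmodule :=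
      iSup_le fun I => I.2
    exact h
  · intro I hI
    have h : I.toSubmodule ≤ (frattiniIdeal F P).toSubmodule :=
      le_iSup (fun I : {I : PoissonIdeal F P // (I : Set P) ⊆ frattini F P} => I.1.toSubmodule)
        ⟨I, hI⟩
    exact h

variable {F P} in
/-- `U · V + [U, V]`: the span of all products `u * v` and all brackets `⁅u, v⁆`. -/
def prod (U V : Submodule F P) : Submodule F P :=
  Submodule.span F {z | ∃ u ∈ U, ∃ v ∈ V, z = u * v ∨ z = ⁅u, v⁆}

/-- The lower central series, indexed from `0`: the term `lowerCentral F P n` is `P^(n+1)`, where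
`P^1 = P` and `P^(n+1) = ∑_{i=1}^{n} (P^i · P^(n+1-i) + [P^i, P^(n+1-i)])`. -/
def lowerCentral : ℕ → Submodule F P
  | 0 => ⊤
  | n + 1 => ⨆ i : Fin (n + 1), prod (lowerCentral i) (lowerCentral (n - i))
termination_by n => n
decreasing_by all_goals omega

/-- `P` is nilpotent: some term of its lower central series vanishes. -/
def IsNilpotent : Prop := ∃ n, lowerCentral F P n = ⊥

/-- `P` is supersolvable: there is a flag `0 = J₀ ⊂ J₁ ⊂ ⋯ ⊂ Jₙ = P` of ideals of `P` with
`dim Jᵢ = i`. -/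
def IsSupersolvable : Prop :=
  ∃ (n : ℕ) (J : ℕ → PoissonIdeal F P),
    (J 0).toSubmodule = ⊥ ∧ (J n).toSubmodule = ⊤ ∧ (∀ i < n, J i < J (i + 1)) ∧
      ∀ i ≤ n, Module.finrank F (J i).toSubmodule = i

end PoissonAlgebra

/-! Let `x ∈ B`. For a derivation, the sum of the generalized eigenspaces with eigenvalues in an
additive submonoid `A` of `F` is a subalgebra, because eigenvalues add under products. For
multiplication by `x` the corresponding sum even absorbs arbitrary products and brackets. If such an
operator is triangularizable modulo `φ(P)` with eigenvalues in `A`, its part `K` satisfies `K + φ(P)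
= P`; but no proper subalgebra supplements `φ(P)`, so `K = P`. Hence triangularizability (`A = ⊤`)
and nilpotency (`A = ⊥`) of the operators lift through `φ(P)`. The subideal chain serves to push `P`
into `B` by powers of `ad x`, after which the hypothesis on `B/C` pushes `B` into `C ⊆ φ(P)`. This
is `reduces_of_quotient`.

It remains to express both properties through single operators (`IsTriangularizable`).
Supersolvability means that all multiplications are triangularizable and that some subspace `N`
containing all brackets acts nilpotently; nilpotency is the case `N = ⊤`. To recover a flag, Engel's
theorem gives a nonzero subspace killed by `N`. All operators commute there, so they share an
eigenvector, which spans a one-dimensional ideal; quotients inherit the condition. -/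

/-! ### Reduction of vectors by shifted operators -/

/-- `v` can be brought into `U` by successively applying maps `T - a` with `a ∈ A`. -/
inductive Reduces {F M : Type*} [Field F] [AddCommGroup M] [Module F M] (A : AddSubmonoid F)
    (T : Module.End F M) (U : Submodule F M) : M → Prop
  | base {v : M} : v ∈ U → Reduces A T U v
  | step {v : M} (a : F) : a ∈ A → Reduces A T U (T v - a • v) → Reduces A T U v

namespace Reduces

variable {F M M' : Type*} [Field F] [AddCommGroup M] [Module F M] [AddCommGroup M'] [Module F M']
  {A : AddSubmonoid F} {T : Module.End F M} {U : Submodule F M} {v w : M}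

theorem trans {U' : Submodule F M} (h : Reduces A T U v) (h' : ∀ u ∈ U, Reduces A T U' u) :
    Reduces A T U' v := by
  induction h with
  | base hu => exact h' _ hu
  | step a ha _ ih => exact .step a ha ih

theorem map {T' : Module.End F M'} {U' : Submodule F M'} (f : M →ₗ[F] M')
    (hf : ∀ m, f (T m) = T' (f m)) (hU : ∀ u ∈ U, f u ∈ U') (h : Reduces A T U v) :
    Reduces A T' U' (f v) := by
  induction h with
  | base hu => exact .base (hU _ hu)
  | step a ha _ ih => exact .step a ha (by simpa [hf] using ih)

theorem comap {T' : Module.End F M'} {U' : Submodule F M'} (f : M →ₗ[F] M')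
    (hf : ∀ m, f (T m) = T' (f m)) (hU : ∀ u, f u ∈ U' → u ∈ U) (h : Reduces A T' U' (f v)) :
    Reduces A T U v := by
  generalize hw : f v = w at h
  induction h generalizing v with
  | base hu => exact .base (hU _ (hw ▸ hu))
  | step a ha _ ih => exact .step a ha (ih (by simp [hf, hw]))

theorem apply_sub (b : F) (h : Reduces A T ⊥ v) : Reduces A T ⊥ (T v - b • v) := by
  induction h with
  | base hu =>
    rw [(Submodule.mem_bot F).1 hu]
    exact .base (by simp)
  | @step v a ha _ ih =>
    refine .step a ha ?_
    convert ih using 1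
    simp only [map_sub, map_smul, smul_sub, smul_comm a b]
    abel

/-- The maps `T - a` commute, so the reduction of `v` can be run on the sum: it kills `v` and leaves
`w` reducible. -/
theorem add (h : Reduces A T ⊥ v) (h' : Reduces A T ⊥ w) : Reduces A T ⊥ (v + w) := by
  induction h generalizing w with
  | base hu => rwa [(Submodule.mem_bot F).1 hu, zero_add]
  | step a ha _ ih =>
    refine .step a ha ?_
    convert ih (h'.apply_sub a) using 1
    simp only [map_add, smul_add]
    abel

theorem smul (c : F) (h : Reduces A T ⊥ v) : Reduces A T ⊥ (c • v) :=
  h.map (c • LinearMap.id) (by simp) (by simp)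

/-- A nonzero vector of an invariant subspace yields an eigenvector in that subspace. -/
theorem exists_eigenvector {W : Submodule F M} (hW : ∀ w ∈ W, T w ∈ W) (h : Reduces A T ⊥ v)
    (hv : v ∈ W) (h0 : v ≠ 0) : ∃ a : F, ∃ w ∈ W, w ≠ 0 ∧ T w = a • w := by
  induction h with
  | base hu => exact absurd ((Submodule.mem_bot F).1 hu) h0
  | @step v a ha _ ih =>
    by_cases h1 : T v - a • v = 0
    · exact ⟨a, v, hv, h0, sub_eq_zero.1 h1⟩
    · exact ih (W.sub_mem (hW _ hv) (W.smul_mem _ hv)) h1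

/-- For `b ≠ a`, the map `T - b` multiplies `v` by `a - b ≠ 0` modulo `U`, so a reduction avoiding
`a` never enters `U`. -/
theorem eigenvalue_mem {a : F} (h : Reduces A T U v) (hU : ∀ u ∈ U, T u ∈ U) (h0 : v ∉ U)
    (hv : T v - a • v ∈ U) : a ∈ A := by
  induction h with
  | base hu => exact absurd hu h0
  | @step v b hb _ ih =>
    by_cases hab : a = b
    · exact hab ▸ hb
    · have e : T v - b • v = (T v - a • v) + (a - b) • v := by rw [sub_smul]; abel
      refine ih (fun hm => h0 ?_) ?_
      · rw [e] at hm
        exact (U.smul_mem_iff (sub_ne_zero.2 hab)).1 ((U.add_mem_iff_right hv).1 hm)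
      · have : T (T v - b • v) - a • (T v - b • v) = T (T v - a • v) - b • (T v - a • v) := by
          simp only [map_sub, map_smul, smul_sub, smul_comm a b]
          abel
        rw [this]
        exact U.sub_mem (hU _ hv) (U.smul_mem _ hv)

theorem isNilpotent [FiniteDimensional F M] (h : ∀ v, Reduces (⊥ : AddSubmonoid F) T ⊥ v) :
    IsNilpotent T := by
  have key : ∀ v, ∃ n, (T ^ n) v = 0 := fun v => by
    induction h v with
    | base hu => exact ⟨0, by simpa using hu⟩
    | step a ha _ ih =>
      obtain ⟨n, hn⟩ := ih
      refine ⟨n + 1, ?_⟩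
      rw [AddSubmonoid.mem_bot.1 ha, zero_smul, sub_zero] at hn
      rw [pow_succ]
      exact hn
  exact Module.End.isNilpotent_iff_of_finite.2 key

end Reduces

/-- The largest subspace on which `T` is triangularizable with all its eigenvalues in `A`. -/
def genEigenspaces {F M : Type*} [Field F] [AddCommGroup M] [Module F M] (A : AddSubmonoid F)
    (T : Module.End F M) : Submodule F M where
  carrier := {v | Reduces A T ⊥ v}
  add_mem' := Reduces.add
  zero_mem' := .base (Submodule.zero_mem _)
  smul_mem' c _ := Reduces.smul c

/-! ### Generalized eigenspaces and common eigenvectors -/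

section LinearAlgebra

variable {F M : Type*} [Field F] [AddCommGroup M] [Module F M] [FiniteDimensional F M]

/-- For `a ∈ A`, `T - a` is injective on `M ⧸ K`, hence by finite dimension bijective on the image
of `U`. So if `(T - a) v ∈ K + U`, some `u ∈ U` satisfies `(T - a) (v - u) ∈ K`, whence `v - u ∈ K`.
-/
theorem genEigenspaces_sup_eq_top {A : AddSubmonoid F} {T : Module.End F M} {U : Submodule F M}
    (hU : ∀ u ∈ U, T u ∈ U) (h : ∀ v, Reduces A T U v) : genEigenspaces A T ⊔ U = ⊤ := by
  set K := genEigenspaces A T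
  refine eq_top_iff.2 fun v _ => ?_
  induction h v with
  | base hu => exact Submodule.mem_sup_right hu
  | @step v a ha _ ih =>
    obtain ⟨k, hk, w, hw, hkw⟩ := Submodule.mem_sup.1 (ih trivial)
    have hT : K ≤ K.comap (T - a • LinearMap.id) := fun x hx => Reduces.apply_sub a hx
    let S : Module.End F (M ⧸ K) := K.mapQ K (T - a • LinearMap.id) hT
    have hS : Function.Injective S := by
      refine (injective_iff_map_eq_zero S).2 fun q => ?_
      obtain ⟨x, rfl⟩ := K.mkQ_surjective q
      intro hx
      simp only [S, Submodule.mkQ_apply, Submodule.mapQ_apply, Submodule.Quotient.mk_eq_zero]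
        at hx ⊢
      exact Reduces.step a ha hx
    have hle : (U.map K.mkQ).map S ≤ U.map K.mkQ := by
      rintro _ ⟨_, ⟨u, hu, rfl⟩, rfl⟩
      exact ⟨T u - a • u, U.sub_mem (hU u hu) (U.smul_mem a hu), rfl⟩
    have heq : (U.map K.mkQ).map S = U.map K.mkQ :=
      Submodule.eq_of_le_of_finrank_eq hle
        (Submodule.equivMapOfInjective S hS _).finrank_eq.symm
    have hmem : K.mkQ w ∈ (U.map K.mkQ).map S := heq.symm ▸ Submodule.mem_map_of_mem hw
    obtain ⟨_, ⟨u, hu, rfl⟩, hu'⟩ := hmem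
    have h1 : (T u - a • u) - w ∈ K := (Submodule.Quotient.eq K).1 hu'
    have h2 : v - u ∈ K := by
      refine Reduces.step a ha ?_
      have : T (v - u) - a • (v - u) = k - ((T u - a • u) - w) := by
        rw [sub_sub_eq_add_sub, hkw, map_sub, smul_sub]
        abel
      rw [this]
      exact K.sub_mem hk h1
    rw [← sub_add_cancel v u]
    exact Submodule.add_mem _ (Submodule.mem_sup_left h2) (Submodule.mem_sup_right hu)

/-- Triangularizable maps commuting on a nonzero invariant subspace have a common eigenvector. -/
theorem exists_common_eigenvector (S : Set (Module.End F M)) (W : Submodule F M) (hW0 : W ≠ ⊥)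
    (hW : ∀ f ∈ S, ∀ w ∈ W, f w ∈ W) (hcomm : ∀ f ∈ S, ∀ g ∈ S, ∀ w ∈ W, f (g w) = g (f w))
    (hS : ∀ f ∈ S, ∀ v, Reduces ⊤ f ⊥ v) :
    ∃ w ∈ W, w ≠ 0 ∧ ∀ f ∈ S, ∃ a : F, f w = a • w := by
  -- On a minimal nonzero invariant subspace every `f ∈ S` is a scalar, since its eigenspace there
  -- is again invariant.
  obtain ⟨V, ⟨hVW, hV0, hV⟩, hmin⟩ := WellFounded.has_min
    (wellFounded_lt (α := Submodule F M))
    {V | V ≤ W ∧ V ≠ ⊥ ∧ ∀ f ∈ S, ∀ w ∈ V, f w ∈ V} ⟨W, le_rfl, hW0, hW⟩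
  obtain ⟨v, hv, hv0⟩ := V.exists_mem_ne_zero_of_ne_bot hV0
  refine ⟨v, hVW hv, hv0, fun f hf => ?_⟩
  obtain ⟨a, w, hw, hw0, hfw⟩ := (hS f hf v).exists_eigenvector (hV f hf) hv hv0
  refine ⟨a, ?_⟩
  by_contra hne
  refine hmin (V ⊓ LinearMap.ker (f - a • LinearMap.id)) ⟨inf_le_left.trans hVW, ?_, ?_⟩ ?_
  · exact fun h => hw0 ((Submodule.mem_bot F).1 (h ▸ ⟨hw, by simp [hfw]⟩))
  · rintro g hg x ⟨hx, hx'⟩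
    refine ⟨hV g hg x hx, ?_⟩
    simp only [LinearMap.mem_ker, LinearMap.sub_apply, LinearMap.smul_apply, LinearMap.id_apply,
      sub_eq_zero, SetLike.mem_coe] at hx' ⊢
    rw [hcomm f hf g hg x (hVW hx), hx', map_smul]
  · refine inf_le_left.lt_of_ne fun h => hne ?_
    have := (h.ge hv).2
    simpa [sub_eq_zero] using this

theorem exists_forall_sub_smul_mem {U W : Submodule F M} (h : U < W)
    (hd : Module.finrank F W = Module.finrank F U + 1) :
    ∃ v ∈ W, v ∉ U ∧ ∀ w ∈ W, ∃ c : F, w - c • v ∈ U := by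
  obtain ⟨hle, v, hv, hvU⟩ := SetLike.lt_iff_le_and_exists.1 h
  refine ⟨v, hv, hvU, fun w hw => ?_⟩
  have hlt : U < U ⊔ F ∙ v := left_lt_sup.2 fun h' => hvU (h' (Submodule.mem_span_singleton_self v))
  have heq : U ⊔ F ∙ v = W := by
    refine Submodule.eq_of_le_of_finrank_le
      (sup_le hle ((Submodule.span_singleton_le_iff_mem v W).2 hv)) ?_
    have := Submodule.finrank_lt_finrank_of_lt hlt
    omega
  rw [← heq] at hw
  obtain ⟨u, hu, y, hy, rfl⟩ := Submodule.mem_sup.1 hw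
  obtain ⟨c, rfl⟩ := Submodule.mem_span_singleton.1 hy
  exact ⟨c, by simpa using hu⟩

end LinearAlgebra

/-! ### Lifting triangularizability through the Frattini ideal -/

section PoissonBasics

variable {F P : Type*} [Field F] [PoissonRing P] [PoissonAlgebra F P]

namespace PoissonAlgebra

/-- Multiplication by `x`. -/
def mulEnd (F : Type*) {P : Type*} [Field F] [PoissonRing P] [PoissonAlgebra F P] (x : P) :
    Module.End F P where
  toFun y := x * y
  map_add' := mul_add x
  map_smul' c y := by rw [mul_comm, smul_mul, mul_comm]; rfl

@[simp] theorem mulEnd_apply (x y : P) : mulEnd F x y = x * y := rfl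

theorem lie_mul (x y z : P) : ⁅x, y * z⁆ = ⁅x, y⁆ * z + y * ⁅x, z⁆ := by
  rw [← lie_skew, PoissonRing.leibniz, ← lie_skew x y, ← lie_skew x z, neg_add, neg_mul, mul_neg]

theorem mul_smul' (c : F) (x y : P) : x * (c • y) = c • (x * y) := (mulEnd F x).map_smul c y

/-- The part of `P` on which the derivation `⁅x, ·⁆` is triangularizable with eigenvalues in `A`. -/
def adPart (A : AddSubmonoid F) (x : P) : PoissonSubalgebra F P where
  toSubmodule := genEigenspaces A (LieAlgebra.ad F P x)
  mul_mem {u v} hu hv := by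
    change Reduces A _ ⊥ _ at hu hv
    change Reduces A _ ⊥ _
    induction hu generalizing v with
    | base hu => rw [(Submodule.mem_bot F).1 hu, zero_mul]; exact .base (Submodule.zero_mem _)
    | @step u a ha hu' ihu =>
      induction hv with
      | base hv => rw [(Submodule.mem_bot F).1 hv, mul_zero]; exact .base (Submodule.zero_mem _)
      | @step v b hb hv' ihv =>
        -- For a derivation `D`, `(D - (a + b)) (u v) = ((D - a) u) v + u ((D - b) v)`; closure of
        -- `A` under addition is used here.
        refine .step (a + b) (A.add_mem ha hb) ?_
        convert (ihu (.step b hb hv')).add ihv using 1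
        simp only [LieAlgebra.ad_apply, lie_mul, sub_mul, mul_sub, smul_mul, mul_smul', add_smul]
        abel
  lie_mem {u v} hu hv := by
    change Reduces A _ ⊥ _ at hu hv
    change Reduces A _ ⊥ _
    induction hu generalizing v with
    | base hu => rw [(Submodule.mem_bot F).1 hu, zero_lie]; exact .base (Submodule.zero_mem _)
    | @step u a ha hu' ihu =>
      induction hv with
      | base hv => rw [(Submodule.mem_bot F).1 hv, lie_zero]; exact .base (Submodule.zero_mem _)
      | @step v b hb hv' ihv =>
        refine .step (a + b) (A.add_mem ha hb) ?_
        convert (ihu (.step b hb hv')).add ihv using 1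
        simp only [LieAlgebra.ad_apply, leibniz_lie x u v, sub_lie, lie_sub, smul_lie, lie_smul,
          add_smul]
        abel

theorem reduces_mulEnd_mul {A : AddSubmonoid F} {x u : P} (h : Reduces A (mulEnd F x) ⊥ u) (z : P) :
    Reduces A (mulEnd F x) ⊥ (u * z) := by
  rw [mul_comm]
  exact h.map (mulEnd F z) (fun m => mul_left_comm z x m) (by simp)

/-- By Leibniz, `x * ⁅u, z⁆ = ⁅x * u, z⁆ - u * ⁅x, z⁆`, and the correction term is reducible by
`reduces_mulEnd_mul`. -/
theorem reduces_mulEnd_lie {A : AddSubmonoid F} {x u : P} (h : Reduces A (mulEnd F x) ⊥ u) (z : P) :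
    Reduces A (mulEnd F x) ⊥ ⁅u, z⁆ := by
  induction h with
  | base hu => rw [(Submodule.mem_bot F).1 hu, zero_lie]; exact .base (Submodule.zero_mem _)
  | @step u a ha hu' ih =>
    refine .step a ha ?_
    have h1 := (reduces_mulEnd_mul (.step a ha hu') ⁅x, z⁆).smul (-1)
    convert ih.add h1 using 1
    simp only [mulEnd_apply, sub_lie, smul_lie, PoissonRing.leibniz, mul_comm u, neg_smul, one_smul]
    abel

/-- The part of `P` on which multiplication by `x` is triangularizable with eigenvalues in `A`. -/
def mulPart (A : AddSubmonoid F) (x : P) : PoissonSubalgebra F P where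
  toSubmodule := genEigenspaces A (mulEnd F x)
  mul_mem {_ v} hu _ := reduces_mulEnd_mul hu v
  lie_mem {_ v} hu _ := reduces_mulEnd_lie hu v

end PoissonAlgebra

namespace PoissonSubalgebra

/-- A proper `K` would lie in a maximal subalgebra, which also contains `φ(P)`. -/
theorem eq_top_of_sup_frattiniIdeal [FiniteDimensional F P] (K : PoissonSubalgebra F P)
    (h : K.toSubmodule ⊔ (PoissonAlgebra.frattiniIdeal F P).toSubmodule = ⊤) : K = ⊤ := by
  have hmono : StrictMono (toSubmodule : PoissonSubalgebra F P → Submodule F P) := fun _ _ h => h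
  have : WellFoundedGT (PoissonSubalgebra F P) := hmono.wellFoundedGT
  have hc : IsCoatomic (PoissonSubalgebra F P) := isCoatomic_of_orderTop_gt_wellFounded wellFounded_gt
  refine (hc.eq_top_or_exists_le_coatom K).resolve_right ?_
  rintro ⟨M, hM, hKM⟩
  refine hM.1 (top_le_iff.1 ?_)
  have h1 : (⊤ : Submodule F P) ≤ M.toSubmodule := by
    rw [← h]
    refine sup_le hKM fun x hx => ?_
    exact (PoissonAlgebra.frattiniIdeal_isGreatest F P).1 hx M hM
  exact h1

end PoissonSubalgebra

namespace PoissonAlgebra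

theorem reduces_ad_of_frattiniIdeal [FiniteDimensional F P] {A : AddSubmonoid F} {x : P}
    (h : ∀ v, Reduces A (LieAlgebra.ad F P x) (frattiniIdeal F P).toSubmodule v) (v : P) :
    Reduces A (LieAlgebra.ad F P x) ⊥ v := by
  have hK := (adPart A x).eq_top_of_sup_frattiniIdeal (genEigenspaces_sup_eq_top (fun u hu => by
    rw [LieAlgebra.ad_apply, ← lie_skew]
    exact Submodule.neg_mem _ ((frattiniIdeal F P).lie_mem hu)) h)
  have hv : v ∈ adPart A x := hK ▸ trivial
  exact hv

theorem reduces_mulEnd_of_frattiniIdeal [FiniteDimensional F P] {A : AddSubmonoid F} {x : P}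
    (h : Reduces A (mulEnd F x) (frattiniIdeal F P).toSubmodule x) (v : P) :
    Reduces A (mulEnd F x) ⊥ v := by
  have h' : ∀ v, Reduces A (mulEnd F x) (frattiniIdeal F P).toSubmodule v := fun v => by
    -- One step with eigenvalue `0` replaces `v` by `v * x`, the image of `x` under an operator that
    -- commutes with multiplication by `x` and preserves `φ(P)`.
    refine .step 0 A.zero_mem ?_
    rw [zero_smul, sub_zero, mulEnd_apply, mul_comm]
    refine h.map (mulEnd F v) (fun m => mul_left_comm v x m) fun u hu => ?_
    rw [mulEnd_apply, mul_comm]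
    exact (frattiniIdeal F P).mul_mem hu
  have hK := (mulPart A x).eq_top_of_sup_frattiniIdeal (genEigenspaces_sup_eq_top (fun u hu => by
    rw [mulEnd_apply, mul_comm]
    exact (frattiniIdeal F P).mul_mem hu) h')
  have hv : v ∈ mulPart A x := hK ▸ trivial
  exact hv

/-- Since `x` lies in every term of the chain, each application of `ad x` descends one term. -/
theorem _root_.PoissonSubalgebra.IsSubideal.reduces_ad {B : PoissonSubalgebra F P}
    (hB : B.IsSubideal) (A : AddSubmonoid F) {x : P} (hx : x ∈ B) (v : P) :
    Reduces A (LieAlgebra.ad F P x) B.toSubmodule v := by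
  obtain ⟨r, c, rfl, hr, hc⟩ := hB
  have hxi : ∀ i ≤ r, x ∈ c i := fun i => by
    induction i with
    | zero => exact fun _ => hx
    | succ i ih => exact fun hi => (hc i hi).1 (ih (by omega))
  have key : ∀ i ≤ r, ∀ v ∈ c i, Reduces A (LieAlgebra.ad F P x) (c 0).toSubmodule v := fun i => by
    induction i with
    | zero => exact fun _ v hv => .base hv
    | succ i ih =>
      intro hi v hv
      refine .step 0 A.zero_mem ?_
      rw [zero_smul, sub_zero]
      exact ih (by omega) _ ((hc i hi).2 x (hxi i (by omega)) v hv).2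
  exact key r le_rfl v (hr ▸ trivial)

/-- Triangularizability modulo `C` of the multiplications of `B` by `b` lifts to `B`. -/
theorem reduces_of_quotient [FiniteDimensional F P] {B : PoissonSubalgebra F P}
    (hB : B.IsSubideal) (C : PoissonIdeal F B) (hC : ∀ x ∈ C, (x : P) ∈ frattiniIdeal F P)
    (A : AddSubmonoid F) (b : B)
    (had : ∀ v : B ⧸ C, Reduces A (LieAlgebra.ad F (B ⧸ C) (C.toQuotient b)) ⊥ v)
    (hmul : ∀ v : B ⧸ C, Reduces A (mulEnd F (C.toQuotient b)) ⊥ v) (v : B) :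
    Reduces A (LieAlgebra.ad F B b) ⊥ v ∧ Reduces A (mulEnd F b) ⊥ v := by
  let q : B →ₗ[F] B ⧸ C := C.toSubmodule.mkQ
  let i : B →ₗ[F] P := B.toSubmodule.subtype
  have hq : ∀ u, q u ∈ (⊥ : Submodule F (B ⧸ C)) → u ∈ C.toSubmodule := fun u hu =>
    (Submodule.Quotient.mk_eq_zero _).1 ((Submodule.mem_bot F).1 hu)
  have hi : ∀ u : B, i u ∈ (⊥ : Submodule F P) → u ∈ (⊥ : Submodule F B) := fun u hu =>
    (Submodule.mem_bot F).2 (Subtype.ext ((Submodule.mem_bot F).1 hu))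
  constructor
  · refine Reduces.comap i (T' := LieAlgebra.ad F P (b : P)) (fun m => rfl) hi ?_
    -- `ad b` first brings `P` into `B`, then `B` into `C`, which lies in `φ(P)`.
    refine reduces_ad_of_frattiniIdeal (fun w => (hB.reduces_ad A b.2 w).trans fun u hu => ?_) _
    exact Reduces.map i (fun m => rfl) hC (Reduces.comap q (T := LieAlgebra.ad F B b)
      (v := ⟨u, hu⟩) (fun m => rfl) hq (had _))
  · refine Reduces.comap i (T' := mulEnd F (b : P)) (fun m => rfl) hi ?_
    -- Only `b` itself has to be reduced, so the subideal chain plays no role for products.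
    refine reduces_mulEnd_of_frattiniIdeal ?_ _
    exact Reduces.map i (fun m => rfl) hC (Reduces.comap q (T := mulEnd F b)
      (v := b) (fun m => rfl) hq (hmul _))

end PoissonAlgebra

end PoissonBasics

/-! ### From triangularizable multiplications to a flag of ideals -/

section Flags

variable {F P : Type*} [Field F] [PoissonRing P] [PoissonAlgebra F P]

namespace PoissonAlgebra

/-- All multiplications of `P` are triangularizable over `F`, and those by elements of `N`, a
subspace containing all brackets, are nilpotent. -/
structure IsTriangularizable (N : Submodule F P) : Prop where
  lie_mem (x y : P) : ⁅x, y⁆ ∈ N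
  ad (x v : P) : Reduces ⊤ (LieAlgebra.ad F P x) ⊥ v
  mul (x v : P) : Reduces ⊤ (mulEnd F x) ⊥ v
  ad_of_mem {z : P} (hz : z ∈ N) (v : P) : Reduces ⊥ (LieAlgebra.ad F P z) ⊥ v
  mul_of_mem {z : P} (hz : z ∈ N) (v : P) : Reduces ⊥ (mulEnd F z) ⊥ v

namespace IsTriangularizable

theorem quotient {N : Submodule F P} (h : IsTriangularizable N) (J : PoissonIdeal F P) :
    IsTriangularizable (P := P ⧸ J) (N.map J.toSubmodule.mkQ) := by
  let q : P →ₗ[F] P ⧸ J := J.toSubmodule.mkQ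
  have hq : Function.Surjective q := J.toSubmodule.mkQ_surjective
  have hbot : ∀ u ∈ (⊥ : Submodule F P), q u ∈ (⊥ : Submodule F (P ⧸ J)) := by simp
  refine ⟨fun x y => ?_, fun x v => ?_, fun x v => ?_, ?_, ?_⟩
  · obtain ⟨x, rfl⟩ := hq x
    obtain ⟨y, rfl⟩ := hq y
    exact ⟨⁅x, y⁆, h.lie_mem x y, rfl⟩
  · obtain ⟨x, rfl⟩ := hq x
    obtain ⟨v, rfl⟩ := hq v
    exact Reduces.map q (T := LieAlgebra.ad F P x) (fun m => rfl) hbot (h.ad x v)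
  · obtain ⟨x, rfl⟩ := hq x
    obtain ⟨v, rfl⟩ := hq v
    exact Reduces.map q (T := mulEnd F x) (fun m => rfl) hbot (h.mul x v)
  · rintro _ ⟨z, hz, rfl⟩ v
    obtain ⟨v, rfl⟩ := hq v
    exact Reduces.map q (T := LieAlgebra.ad F P z) (fun m => rfl) hbot (h.ad_of_mem hz v)
  · rintro _ ⟨z, hz, rfl⟩ v
    obtain ⟨v, rfl⟩ := hq v
    exact Reduces.map q (T := mulEnd F z) (fun m => rfl) hbot (h.mul_of_mem hz v)

/-- The elements annihilated by multiplication by `N`, as a submodule of the adjoint module. -/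
def mulAnnihilator {N : Submodule F P} (h : IsTriangularizable N) : LieSubmodule F P P where
  carrier := {v | ∀ z ∈ N, z * v = 0}
  add_mem' hu hv z hz := by rw [mul_add, hu z hz, hv z hz, add_zero]
  zero_mem' z _ := mul_zero z
  smul_mem' c v hv z hz := by rw [mul_smul', hv z hz, smul_zero]
  lie_mem {x v} hv z hz := by
    have h1 := lie_mul x z v
    rwa [hv z hz, hv _ (h.lie_mem x z), lie_zero, zero_add, eq_comm] at h1

/-- The associative multiplications commute and so share an eigenvector; elements of `N` act
nilpotently, so their eigenvalues on it vanish. -/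
theorem exists_ne_zero_mulAnnihilator [FiniteDimensional F P] [Nontrivial P] {N : Submodule F P}
    (h : IsTriangularizable N) : ∃ v ∈ h.mulAnnihilator, v ≠ 0 := by
  obtain ⟨v, -, hv0, hv⟩ := exists_common_eigenvector (Set.range (mulEnd F (P := P))) ⊤ top_ne_bot
    (fun _ _ _ _ => trivial) (by rintro _ ⟨x, rfl⟩ _ ⟨y, rfl⟩ w _; exact mul_left_comm x y w)
    (by rintro _ ⟨x, rfl⟩; exact h.mul x)
  refine ⟨v, fun z hz => ?_, hv0⟩
  obtain ⟨a, ha⟩ := hv _ ⟨z, rfl⟩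
  have ha0 : a ∈ (⊥ : AddSubmonoid F) :=
    (h.mul_of_mem hz v).eigenvalue_mem (by simp) (by simpa using hv0) (by simp [ha])
  rw [← mulEnd_apply (F := F), ha, AddSubmonoid.mem_bot.1 ha0, zero_smul]

/-- By Engel's theorem some nonzero element is annihilated by both multiplications by `N`. -/
theorem exists_ne_zero_annihilated [FiniteDimensional F P] [Nontrivial P] {N : Submodule F P}
    (h : IsTriangularizable N) : ∃ v : P, v ≠ 0 ∧ ∀ z ∈ N, z * v = 0 ∧ ⁅z, v⁆ = 0 := by
  let I : LieIdeal F P := { N with lie_mem := fun {x m} _ => h.lie_mem x m }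
  obtain ⟨w, hw, hw0⟩ := h.exists_ne_zero_mulAnnihilator
  have : Nontrivial h.mulAnnihilator := ⟨⟨⟨w, hw⟩, 0, fun e => hw0 (congrArg Subtype.val e)⟩⟩
  have : LieModule.IsNilpotent I h.mulAnnihilator := by
    refine (LieModule.isNilpotent_iff_forall' (R := F)).2 fun z => Reduces.isNilpotent fun v => ?_
    exact Reduces.comap (T' := LieAlgebra.ad F P z.1) h.mulAnnihilator.toSubmodule.subtype
      (fun m => rfl) (fun u hu => (Submodule.mem_bot F).2 (Subtype.ext ((Submodule.mem_bot F).1 hu)))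
      (h.ad_of_mem z.2 v)
  have hnt := LieModule.nontrivial_max_triv_of_isNilpotent F I h.mulAnnihilator
  obtain ⟨v, hv⟩ := exists_ne (0 : LieModule.maxTrivSubmodule F I h.mulAnnihilator)
  refine ⟨v.1.1, fun e => hv (Subtype.ext (Subtype.ext e)), fun z hz => ⟨v.1.2 z hz, ?_⟩⟩
  exact congrArg Subtype.val ((LieModule.mem_maxTrivSubmodule F I _ v.1).1 v.2 ⟨z, hz⟩)

/-- On the subspace `W` killed by `N`, all multiplications commute: the commutators of `ad x` with
`ad y` and with multiplication by `y` are the two multiplications by `⁅x, y⁆ ∈ N`. -/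
theorem exists_eigenvector [FiniteDimensional F P] [Nontrivial P] {N : Submodule F P}
    (h : IsTriangularizable N) :
    ∃ v : P, v ≠ 0 ∧ ∀ x : P, (∃ a : F, x * v = a • v) ∧ ∃ a : F, ⁅x, v⁆ = a • v := by
  let W : Submodule F P :=
    { carrier := {v | ∀ z ∈ N, z * v = 0 ∧ ⁅z, v⁆ = 0}
      add_mem' := fun hu hv z hz => by
        simp [mul_add, (hu z hz).1, (hv z hz).1, (hu z hz).2, (hv z hz).2]
      zero_mem' := fun z _ => by simp
      smul_mem' := fun c v hv z hz => by simp [mul_smul', (hv z hz).1, (hv z hz).2] }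
  have hWm : ∀ x, ∀ w ∈ W, x * w ∈ W := fun x w hw z hz => by
    constructor
    · rw [mul_left_comm, (hw z hz).1, mul_zero]
    · rw [lie_mul, (hw z hz).2, (hw _ (h.lie_mem z x)).1, mul_zero, add_zero]
  have hWl : ∀ x, ∀ w ∈ W, ⁅x, w⁆ ∈ W := fun x w hw z hz => by
    constructor
    · have h1 := lie_mul x z w
      rwa [(hw z hz).1, (hw _ (h.lie_mem x z)).1, lie_zero, zero_add, eq_comm] at h1
    · rw [leibniz_lie, (hw _ (h.lie_mem z x)).2, (hw z hz).2, lie_zero, add_zero]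
  have hml : ∀ x y, ∀ w ∈ W, ⁅x, y * w⁆ = y * ⁅x, w⁆ := fun x y w hw => by
    rw [lie_mul, (hw _ (h.lie_mem x y)).1, zero_add]
  obtain ⟨u, hu0, hu⟩ := h.exists_ne_zero_annihilated
  obtain ⟨v, -, hv0, hv⟩ := exists_common_eigenvector
    (Set.range (mulEnd F (P := P)) ∪ Set.range (LieAlgebra.ad F P)) W
    (fun e => hu0 ((Submodule.mem_bot F).1 (e ▸ (show u ∈ W from hu))))
    (by rintro _ (⟨x, rfl⟩ | ⟨x, rfl⟩) w hw; exacts [hWm x w hw, hWl x w hw])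
    (by
      rintro _ (⟨x, rfl⟩ | ⟨x, rfl⟩) _ (⟨y, rfl⟩ | ⟨y, rfl⟩) w hw
      · exact mul_left_comm x y w
      · exact (hml y x w hw).symm
      · exact hml x y w hw
      · change ⁅x, ⁅y, w⁆⁆ = ⁅y, ⁅x, w⁆⁆
        rw [leibniz_lie, (hw _ (h.lie_mem x y)).2, zero_add])
    (by rintro _ (⟨x, rfl⟩ | ⟨x, rfl⟩) w; exacts [h.mul x w, h.ad x w])
  exact ⟨v, hv0, fun x => ⟨hv _ (.inl ⟨x, rfl⟩), hv _ (.inr ⟨x, rfl⟩)⟩⟩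

theorem exists_eigenvector_mod [FiniteDimensional F P] {N : Submodule F P}
    (h : IsTriangularizable N) (J : PoissonIdeal F P) (hJ : J.toSubmodule ≠ ⊤) :
    ∃ v : P, v ∉ J.toSubmodule ∧
      ∀ x : P, (∃ a : F, x * v - a • v ∈ J.toSubmodule) ∧ ∃ a : F, ⁅x, v⁆ - a • v ∈ J.toSubmodule := by
  have : Nontrivial (P ⧸ J) := Submodule.Quotient.nontrivial_iff.2 hJ
  have : FiniteDimensional F (P ⧸ J) := inferInstanceAs (FiniteDimensional F (P ⧸ J.toSubmodule))
  obtain ⟨w, hw0, hw⟩ := (h.quotient J).exists_eigenvector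
  obtain ⟨v, rfl⟩ := J.toSubmodule.mkQ_surjective w
  refine ⟨v, fun hv => hw0 ((Submodule.Quotient.mk_eq_zero _).2 hv), fun x => ?_⟩
  obtain ⟨⟨a, ha⟩, b, hb⟩ := hw (J.toQuotient x)
  exact ⟨⟨a, (Submodule.Quotient.eq J.toSubmodule).1 ha⟩,
    ⟨b, (Submodule.Quotient.eq J.toSubmodule).1 hb⟩⟩

theorem exists_ideal_finrank_add_one [FiniteDimensional F P] {N : Submodule F P}
    (h : IsTriangularizable N) (J : PoissonIdeal F P) (hJ : J.toSubmodule ≠ ⊤) :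
    ∃ J' : PoissonIdeal F P, J < J' ∧
      Module.finrank F J'.toSubmodule = Module.finrank F J.toSubmodule + 1 := by
  obtain ⟨v, hv, hx⟩ := h.exists_eigenvector_mod J hJ
  have key : ∀ T : Module.End F P, (∀ u ∈ J.toSubmodule, T u ∈ J.toSubmodule) →
      (∃ a : F, T v - a • v ∈ J.toSubmodule) →
      ∀ u ∈ J.toSubmodule ⊔ F ∙ v, T u ∈ J.toSubmodule ⊔ F ∙ v := by
    rintro T hT ⟨a, ha⟩ u hu
    obtain ⟨j, hj, y, hy, rfl⟩ := Submodule.mem_sup.1 hu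
    obtain ⟨c, rfl⟩ := Submodule.mem_span_singleton.1 hy
    rw [map_add, map_smul]
    refine Submodule.add_mem _ (Submodule.mem_sup_left (hT j hj)) (Submodule.smul_mem _ c ?_)
    rw [← sub_add_cancel (T v) (a • v)]
    exact Submodule.add_mem _ (Submodule.mem_sup_left ha)
      (Submodule.mem_sup_right (Submodule.smul_mem _ a (Submodule.mem_span_singleton_self v)))
  refine ⟨{ J.toSubmodule ⊔ F ∙ v with
    mul_mem := fun {u y} hu => ?_
    lie_mem := fun {u y} hu => ?_ }, ?_, Submodule.finrank_sup_span_singleton hv⟩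
  · rw [mul_comm]
    exact key (mulEnd F y) (fun j hj => by
      rw [mulEnd_apply, mul_comm]; exact J.mul_mem hj) (hx y).1 u hu
  · rw [← lie_skew]
    refine Submodule.neg_mem _ (key (LieAlgebra.ad F P y) (fun j hj => ?_) (hx y).2 u hu)
    rw [LieAlgebra.ad_apply, ← lie_skew]
    exact Submodule.neg_mem _ (J.lie_mem hj)
  · have h1 : J.toSubmodule < J.toSubmodule ⊔ F ∙ v :=
      left_lt_sup.2 fun h' => hv (h' (Submodule.mem_span_singleton_self v))
    exact h1

theorem isSupersolvable [FiniteDimensional F P] {N : Submodule F P}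
    (h : IsTriangularizable N) : IsSupersolvable F P := by
  classical
  choose f hf using h.exists_ideal_finrank_add_one
  let z : PoissonIdeal F P :=
    { (⊥ : Submodule F P) with
      mul_mem := fun {x y} hx => by
        rw [(Submodule.mem_bot F).1 hx, zero_mul]; exact Submodule.zero_mem _
      lie_mem := fun {x y} hx => by
        rw [(Submodule.mem_bot F).1 hx, zero_lie]; exact Submodule.zero_mem _ }
  -- The sequence is constant once it reaches `P`; only indices up to `dim P` matter.
  let J : ℕ → PoissonIdeal F P := fun n =>
    Nat.rec z (fun _ I => if hI : I.toSubmodule ≠ ⊤ then f I hI else I) n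
  have hs : ∀ i, (hI : (J i).toSubmodule ≠ ⊤) → J (i + 1) = f (J i) hI := fun i hI => dif_pos hI
  have hd : ∀ i ≤ Module.finrank F P, Module.finrank F (J i).toSubmodule = i := fun i => by
    induction i with
    | zero => exact fun _ => finrank_bot F P
    | succ i ih =>
      intro hi
      have hne : (J i).toSubmodule ≠ ⊤ := fun e => by
        have := ih (by omega)
        rw [e, finrank_top] at this
        omega
      rw [hs i hne, (hf _ hne).2, ih (by omega)]
  refine ⟨Module.finrank F P, J, rfl, Submodule.eq_top_of_finrank_eq (hd _ le_rfl), ?_, hd⟩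
  intro i hi
  have hne : (J i).toSubmodule ≠ ⊤ := fun e => by
    have := hd i hi.le
    rw [e, finrank_top] at this
    omega
  rw [hs i hne]
  exact (hf _ hne).1

end IsTriangularizable

end PoissonAlgebra

end Flags

/-! ### Supersolvability and nilpotency in terms of single operators -/

theorem exists_forall_map_sub_smul_mem {F M : Type*} [Field F] [AddCommGroup M] [Module F M]
    [FiniteDimensional F M] {U W : Submodule F M} (h : U < W)
    (hd : Module.finrank F W = Module.finrank F U + 1) (T : Module.End F M)
    (hU : ∀ u ∈ U, T u ∈ U) (hW : ∀ w ∈ W, T w ∈ W) :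
    ∃ a : F, ∀ w ∈ W, T w - a • w ∈ U := by
  obtain ⟨v, hv, -, hvW⟩ := exists_forall_sub_smul_mem h hd
  obtain ⟨a, ha⟩ := hvW _ (hW v hv)
  refine ⟨a, fun w hw => ?_⟩
  obtain ⟨c, hc⟩ := hvW w hw
  have : T w - a • w = c • (T v - a • v) + (T (w - c • v) - a • (w - c • v)) := by
    simp only [map_sub, map_smul, smul_sub, smul_comm a c]
    abel
  rw [this]
  exact U.add_mem (U.smul_mem c ha) (U.sub_mem (hU _ hc) (U.smul_mem a hc))

/-- Scalars commute. This puts all brackets into the subspace acting as zero on the factors of a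
flag. -/
theorem commutator_apply_mem {F M : Type*} [Field F] [AddCommGroup M] [Module F M]
    {U W : Submodule F M} {S T : Module.End F M} {a b : F} (hSW : ∀ w ∈ W, S w ∈ W)
    (hTW : ∀ w ∈ W, T w ∈ W) (hS : ∀ w ∈ W, S w - a • w ∈ U) (hT : ∀ w ∈ W, T w - b • w ∈ U)
    {w : M} (hw : w ∈ W) : S (T w) - T (S w) ∈ U := by
  have : S (T w) - T (S w) = (S (T w) - a • T w) + a • (T w - b • w) - (T (S w) - b • S w)
      - b • (S w - a • w) := by
    simp only [smul_sub, smul_comm a b]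
    abel
  rw [this]
  exact U.sub_mem (U.sub_mem (U.add_mem (hS _ (hTW w hw)) (U.smul_mem a (hT w hw)))
    (hT _ (hSW w hw))) (U.smul_mem b (hS w hw))

section Criteria

variable {F P : Type*} [Field F] [PoissonRing P] [PoissonAlgebra F P]

theorem PoissonIdeal.mulEnd_mem (I : PoissonIdeal F P) (x : P) :
    ∀ u ∈ I.toSubmodule, PoissonAlgebra.mulEnd F x u ∈ I.toSubmodule := fun u hu => by
  rw [PoissonAlgebra.mulEnd_apply, mul_comm]
  exact I.mul_mem hu

theorem PoissonIdeal.ad_mem (I : PoissonIdeal F P) (x : P) :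
    ∀ u ∈ I.toSubmodule, LieAlgebra.ad F P x u ∈ I.toSubmodule := fun u hu => by
  rw [LieAlgebra.ad_apply, ← lie_skew]
  exact Submodule.neg_mem _ (I.lie_mem hu)

/-- A map acting by scalars in `A` on the factors of a chain ending at `0` reduces to `0`. -/
theorem Reduces.of_chain {F M : Type*} [Field F] [AddCommGroup M] [Module F M]
    {A : AddSubmonoid F} {T : Module.End F M} {n : ℕ} (J : ℕ → Submodule F M) (h0 : J 0 = ⊥)
    (hJ : ∀ i < n, ∃ a ∈ A, ∀ v ∈ J (i + 1), T v - a • v ∈ J i) :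
    ∀ i ≤ n, ∀ v ∈ J i, Reduces A T ⊥ v := fun i => by
  induction i with
  | zero => exact fun _ v hv => .base (h0 ▸ hv)
  | succ i ih =>
    intro hi v hv
    obtain ⟨a, ha, hav⟩ := hJ i hi
    exact .step a ha (ih (by omega) _ (hav v hv))

namespace PoissonAlgebra

/-- Every multiplication acts by a scalar on each one-dimensional factor of the flag; `N` consists
of the elements for which all these scalars are zero. -/
theorem IsSupersolvable.exists_isTriangularizable [FiniteDimensional F P]
    (h : IsSupersolvable F P) : ∃ N : Submodule F P, IsTriangularizable N := by
  obtain ⟨n, J, h0, hn, hlt, hd⟩ := h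
  have hmul : ∀ i < n, ∀ x : P, ∃ a : F, ∀ w ∈ (J (i + 1)).toSubmodule,
      mulEnd F x w - a • w ∈ (J i).toSubmodule := fun i hi x =>
    exists_forall_map_sub_smul_mem (hlt i hi) (by rw [hd _ hi, hd i hi.le]) _
      ((J i).mulEnd_mem x) ((J (i + 1)).mulEnd_mem x)
  have had : ∀ i < n, ∀ x : P, ∃ a : F, ∀ w ∈ (J (i + 1)).toSubmodule,
      LieAlgebra.ad F P x w - a • w ∈ (J i).toSubmodule := fun i hi x =>
    exists_forall_map_sub_smul_mem (hlt i hi) (by rw [hd _ hi, hd i hi.le]) _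
      ((J i).ad_mem x) ((J (i + 1)).ad_mem x)
  let N : Submodule F P :=
    { carrier := {z | ∀ i < n, ∀ v ∈ (J (i + 1)).toSubmodule,
        z * v ∈ (J i).toSubmodule ∧ ⁅z, v⁆ ∈ (J i).toSubmodule}
      add_mem' := fun {y z} hy hz i hi v hv => by
        rw [add_mul, add_lie]
        exact ⟨Submodule.add_mem _ (hy i hi v hv).1 (hz i hi v hv).1,
          Submodule.add_mem _ (hy i hi v hv).2 (hz i hi v hv).2⟩
      zero_mem' := fun i hi v hv => by simp
      smul_mem' := fun c z hz i hi v hv => by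
        rw [smul_mul, smul_lie]
        exact ⟨Submodule.smul_mem _ c (hz i hi v hv).1, Submodule.smul_mem _ c (hz i hi v hv).2⟩ }
  have hmem : ∀ v : P, v ∈ (J n).toSubmodule := fun v => hn ▸ trivial
  refine ⟨N, fun x y i hi v hv => ?_, fun x v => ?_, fun x v => ?_, fun {z} hz v => ?_,
    fun {z} hz v => ?_⟩
  · obtain ⟨a, ha⟩ := had i hi x
    obtain ⟨b, hb⟩ := had i hi y
    obtain ⟨c, hc⟩ := hmul i hi y
    constructor
    · have h1 := commutator_apply_mem ((J (i + 1)).ad_mem x) ((J (i + 1)).mulEnd_mem y) ha hc hv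
      rwa [LieAlgebra.ad_apply, mulEnd_apply, lie_mul, mulEnd_apply, LieAlgebra.ad_apply,
        add_sub_cancel_right] at h1
    · have h1 := commutator_apply_mem ((J (i + 1)).ad_mem x) ((J (i + 1)).ad_mem y) ha hb hv
      rw [lie_lie]
      exact h1
  · exact Reduces.of_chain (fun i => (J i).toSubmodule) h0
      (fun i hi => (had i hi x).imp fun a ha => ⟨AddSubmonoid.mem_top a, ha⟩) n le_rfl v (hmem v)
  · exact Reduces.of_chain (fun i => (J i).toSubmodule) h0
      (fun i hi => (hmul i hi x).imp fun a ha => ⟨AddSubmonoid.mem_top a, ha⟩) n le_rfl v (hmem v)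
  · exact Reduces.of_chain (fun i => (J i).toSubmodule) h0
      (fun i hi => ⟨0, zero_mem _, fun w hw => by simpa using (hz i hi w hw).2⟩) n le_rfl v (hmem v)
  · exact Reduces.of_chain (fun i => (J i).toSubmodule) h0
      (fun i hi => ⟨0, zero_mem _, fun w hw => by simpa using (hz i hi w hw).1⟩) n le_rfl v (hmem v)

theorem mem_lowerCentral_succ (x : P) {n : ℕ} {v : P} (hv : v ∈ lowerCentral F P n) :
    x * v ∈ lowerCentral F P (n + 1) ∧ ⁅x, v⁆ ∈ lowerCentral F P (n + 1) := by
  have h : prod ⊤ (lowerCentral F P n) ≤ lowerCentral F P (n + 1) := by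
    rw [lowerCentral]
    refine le_trans (le_of_eq ?_) (le_iSup _ (0 : Fin (n + 1)))
    simp [lowerCentral]
  exact ⟨h (Submodule.subset_span ⟨x, trivial, v, hv, .inl rfl⟩),
    h (Submodule.subset_span ⟨x, trivial, v, hv, .inr rfl⟩)⟩

theorem IsNilpotent.isTriangularizable (h : IsNilpotent F P) :
    IsTriangularizable (⊤ : Submodule F P) := by
  obtain ⟨n, hn⟩ := h
  have key : ∀ T : Module.End F P,
      (∀ i, ∀ v ∈ lowerCentral F P i, T v ∈ lowerCentral F P (i + 1)) →
      ∀ A : AddSubmonoid F, ∀ v, Reduces A T ⊥ v := fun T hT A v => by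
    refine Reduces.of_chain (n := n) (fun i => lowerCentral F P (n - i)) hn
      (fun i hi => ⟨0, A.zero_mem, fun w hw => ?_⟩) n le_rfl v (by simp [lowerCentral])
    rw [zero_smul, sub_zero, show n - i = n - (i + 1) + 1 by omega]
    exact hT _ w hw
  exact ⟨fun _ _ => trivial, fun x => key _ (fun i v hv => (mem_lowerCentral_succ x hv).2) _,
    fun x => key _ (fun i v hv => (mem_lowerCentral_succ x hv).1) _,
    fun {x} _ => key _ (fun i v hv => (mem_lowerCentral_succ x hv).2) _,
    fun {x} _ => key _ (fun i v hv => (mem_lowerCentral_succ x hv).1) _⟩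

/-- The lower central series involves products of arbitrary bracketing, so each descent in the chain
is paid for by doubling the degree: in a product of two terms, one has at least half the total
degree. -/
theorem lowerCentral_le_of_central_chain {n : ℕ} (J : ℕ → PoissonIdeal F P)
    (hn : (J n).toSubmodule = ⊤)
    (hJ : ∀ i < n, ∀ x : P, ∀ v ∈ (J (i + 1)).toSubmodule,
      x * v ∈ (J i).toSubmodule ∧ ⁅x, v⁆ ∈ (J i).toSubmodule) :
    ∀ k ≤ n, ∀ m, 2 ^ k ≤ m + 1 → lowerCentral F P m ≤ (J (n - k)).toSubmodule := fun k => by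
  induction k with
  | zero => exact fun _ m _ => by rw [Nat.sub_zero, hn]; exact le_top
  | succ k ih =>
    intro hk m hm
    rw [pow_succ] at hm
    have hpos : 0 < 2 ^ k := by positivity
    obtain ⟨m, rfl⟩ : ∃ m', m = m' + 1 := ⟨m - 1, by omega⟩
    have hJ' := hJ (n - (k + 1)) (by omega)
    rw [show n - (k + 1) + 1 = n - k by omega] at hJ'
    rw [lowerCentral]
    refine iSup_le fun i => Submodule.span_le.2 ?_
    rintro _ ⟨u, hu, v, hv, hz⟩
    have hi := i.2
    -- The factors have degrees `i + 1` and `m - i + 1`, with sum `m + 2 ≥ 2 ^ (k + 1)`.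
    rcases le_or_gt (2 ^ k) (i + 1 : ℕ) with hik | hik
    · have hu' := hJ' v u (ih (by omega) _ hik hu)
      rcases hz with rfl | rfl
      · rw [mul_comm]; exact hu'.1
      · rw [← lie_skew]; exact Submodule.neg_mem _ hu'.2
    · have hv' := hJ' u v (ih (by omega) _ (by omega) hv)
      rcases hz with rfl | rfl
      exacts [hv'.1, hv'.2]

/-- With `N = ⊤` every scalar on a factor of the flag is an eigenvalue of a nilpotent operator,
hence `0`, so the flag is a central chain. -/
theorem IsTriangularizable.isNilpotent [FiniteDimensional F P]
    (h : IsTriangularizable (⊤ : Submodule F P)) : IsNilpotent F P := by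
  obtain ⟨n, J, h0, hn, hlt, hd⟩ := h.isSupersolvable
  have key : ∀ T : Module.End F P, (∀ i, ∀ u ∈ (J i).toSubmodule, T u ∈ (J i).toSubmodule) →
      (∀ v, Reduces ⊥ T ⊥ v) → ∀ i < n, ∀ v ∈ (J (i + 1)).toSubmodule, T v ∈ (J i).toSubmodule := by
    intro T hT hr i hi v hv
    obtain ⟨a, ha⟩ := exists_forall_map_sub_smul_mem (hlt i hi) (by rw [hd _ hi, hd i hi.le]) T
      (hT i) (hT (i + 1))
    by_cases hvi : v ∈ (J i).toSubmodule
    · exact hT i v hvi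
    · have ha0 : a ∈ (⊥ : AddSubmonoid F) :=
        Reduces.eigenvalue_mem ((hr v).trans fun u hu => .base ((Submodule.mem_bot F).1 hu ▸
          Submodule.zero_mem _)) (hT i) hvi (ha v hv)
      simpa [AddSubmonoid.mem_bot.1 ha0] using ha v hv
  refine ⟨2 ^ n, ?_⟩
  have := lowerCentral_le_of_central_chain J hn (fun i hi x v hv =>
    ⟨key _ (fun i => (J i).mulEnd_mem x) (h.mul_of_mem trivial) i hi v hv,
      key _ (fun i => (J i).ad_mem x) (h.ad_of_mem trivial) i hi v hv⟩) n le_rfl (2 ^ n) (by omega)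
  rwa [Nat.sub_self, h0, le_bot_iff] at this

theorem IsTriangularizable.of_quotient [FiniteDimensional F P] {B : PoissonSubalgebra F P}
    (hB : B.IsSubideal) (C : PoissonIdeal F B) (hC : ∀ x ∈ C, (x : P) ∈ frattiniIdeal F P)
    {N : Submodule F (B ⧸ C)} (h : IsTriangularizable N) :
    IsTriangularizable (N.comap (C.toSubmodule.mkQ : B →ₗ[F] B ⧸ C)) where
  lie_mem x y := h.lie_mem (C.toQuotient x) (C.toQuotient y)
  ad x v := (reduces_of_quotient hB C hC _ x (h.ad _) (h.mul _) v).1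
  mul x v := (reduces_of_quotient hB C hC _ x (h.ad _) (h.mul _) v).2
  ad_of_mem hz v := (reduces_of_quotient hB C hC _ _ (h.ad_of_mem hz) (h.mul_of_mem hz) v).1
  mul_of_mem hz v := (reduces_of_quotient hB C hC _ _ (h.ad_of_mem hz) (h.mul_of_mem hz) v).2

end PoissonAlgebra

end Criteria

theorem mainTheorem3 {F P : Type*} [Field F] [PoissonRing P] [PoissonAlgebra F P]
    [FiniteDimensional F P] (B : PoissonSubalgebra F P) (hB : B.IsSubideal)
    (C : PoissonIdeal F B) (hC : ∀ x ∈ C, (x : P) ∈ PoissonAlgebra.frattiniIdeal F P) :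
    (PoissonAlgebra.IsNilpotent F (B ⧸ C) → PoissonAlgebra.IsNilpotent F B) ∧
      (PoissonAlgebra.IsSupersolvable F (B ⧸ C) → PoissonAlgebra.IsSupersolvable F B) := by
  have : FiniteDimensional F B := inferInstanceAs (FiniteDimensional F B.toSubmodule)
  have : FiniteDimensional F (B ⧸ C) := inferInstanceAs (FiniteDimensional F (B ⧸ C.toSubmodule))
  refine ⟨fun h => ?_, fun h => ?_⟩
  · exact (h.isTriangularizable.of_quotient hB C hC).isNilpotent
  · obtain ⟨N, hN⟩ := h.exists_isTriangularizable
    exact (hN.of_quotient hB C hC).isSupersolvable
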